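/- For a finite abelian group $G$ let $\mathcal C(G)\subset\mathbb R^{G}$ be the polyhedral cone of all $x$ with $x_0=0$ and $x_i+x_j\ge x_{i+j}$ for all $i,j\in G\setminus\{0\}$ with $i+j\neq 0$; if $|G|=2$, where there is no such pair, $\mathcal C(G)$ is the half-line $x_0=0$, $x_i\ge 0$ ($i\ne 0$). A face of $\mathcal C(G)$ is a subset cut out of $\mathcal C(G)$ by turning some (possibly none) of these defining inequalities into equalities. The Kunz subgroup of a face $F$ is $\{h\in G : x_h=0 \text{ for all } x\in F\}$; writing $K$ for it, the Kunz poset of $F$ is the poset on $G/K$ in which $\overline a\preceq\overline b$ if and only if $x_a+x_{b-a}=x_b$ for all $x\in F$. Let $G$ be a finite abelian group, $H\subset G$ a subgroup with $G/H$ cyclic, $\beta=|G/H|$, and $\rho\in G$ an element whose image generates $G/H$, so that every element of $G$ is uniquely of the form $a+b\rho$ with $a\in H$ and $0\le b<\beta$. Define $\Phi_\rho:\mathcal C(H)\to\mathcal C(G)$ by $\Phi_\rho(w)_{a+b\rho}=\beta w_a+b\,w_{\beta\rho}$ and $\vec s\in\mathbb R^G$ by $\vec s_{a+b\rho}=b$,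 for $a\in H$ and $0\le b<\beta$. Theorem. Let $F$ be any face of $\mathcal C(H)$, with Kunz subgroup $H'$ and Kunz poset $P=(H/H',\preceq_P)$. Then the set $$\mathbb R_{\ge 0}\,\vec s+\Phi_\rho(F)=\{c\,\vec s+\Phi_\rho(w) : c\ge 0,\ w\in F\}$$ is a face of $\mathcal C(G)$. Its Kunz subgroup is $H'$ (as a subgroup of $G$), and its Kunz poset is the monoscopic extension of $P$ along $\rho$, that is, the poset $(G/H',\preceq_Q)$ in which, for $a,a'\in H/H'$ and $0\le b,b'<\beta$, $a+b\rho\preceq_Q a'+b'\rho$ if and only if $a\preceq_P a'$ and $b\le b'$. In particular the map $(a,b)\mapsto a+b\rho$ is an isomorphism of posets from the product of $P$ with the chain $0<1<\cdots<\beta-1$ to this Kunz poset. -/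

import Mathlib

/-! ### The group cone, its faces, and their Kunz posets

Points of the group cone are written with an additional coordinate, indexed by `0`, which is `0`. -/

/-- The pairs `(i, j)` that index the facet inequalities `x i + x j ≥ x (i + j)` of the group cone:
`i`, `j` and `i + j` are nonzero. The group with two elements has no such pair; there the pointed
cone is the half-line `x 1 ≥ 0`, given by the one pair `(1, 1)`, whose inequality is
`x 1 + x 1 ≥ x 0 = 0`. -/
def IsFacetIndex {G : Type*} [AddCommGroup G] (i j : G) : Prop :=
  i ≠ 0 ∧ j ≠ 0 ∧ (i + j ≠ 0 ∨ Nat.card G = 2)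

/-- The group cone `C(G)`. -/
def groupCone (G : Type*) [AddCommGroup G] : Set (G → ℝ) :=
  {x | x 0 = 0 ∧ ∀ i j : G, IsFacetIndex i j → x (i + j) ≤ x i + x j}

/-- A face of `C(G)` is the intersection (within `C(G)`) of a collection of facets; the empty
collection gives `C(G)` itself. -/
def IsFace {G : Type*} [AddCommGroup G] (F : Set (G → ℝ)) : Prop :=
  ∃ T : Set (G × G), (∀ p ∈ T, IsFacetIndex p.1 p.2) ∧
    F = {x | x ∈ groupCone G ∧ ∀ p ∈ T, x p.1 + x p.2 = x (p.1 + p.2)}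

theorem groupCone_add_le {G : Type*} [AddCommGroup G] [Finite G] {x : G → ℝ}
    (hx : x ∈ groupCone G) (i j : G) : x (i + j) ≤ x i + x j := by
  obtain ⟨h0, hx⟩ := hx
  by_cases hi : i = 0
  · simp [hi, h0]
  by_cases hj : j = 0
  · simp [hj, h0]
  by_cases hij : i + j = 0
  · by_cases hc : Nat.card G = 2
    · exact hx i j ⟨hi, hj, Or.inr hc⟩
    · have hk : ∃ k : G, k ≠ 0 ∧ k ≠ j := by
        by_contra! hk
        apply hc
        rw [Nat.card_eq_two_iff]
        refine ⟨0, j, fun h => hj h.symm, ?_⟩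
        ext k
        by_cases h : k = 0
        · simp [h]
        · simp [hk k h]
      obtain ⟨k, hk0, hkj⟩ := hk
      have hij' : i = -j := eq_neg_of_add_eq_zero_left hij
      have hik : i + k ≠ 0 := by
        intro h
        apply hkj
        rw [hij'] at h
        exact (neg_add_eq_zero.mp h).symm
      have e : j + (i + k) = k := by rw [hij']; abel
      have h1 := hx i k ⟨hi, hk0, Or.inl hik⟩
      have h2 := hx j (i + k) ⟨hj, hik, Or.inl (by rw [e]; exact hk0)⟩
      rw [e] at h2
      rw [hij, h0]
      linarith
  · exact hx i j ⟨hi, hj, Or.inl hij⟩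

theorem groupCone_nonneg {G : Type*} [AddCommGroup G] [Finite G] {x : G → ℝ}
    (hx : x ∈ groupCone G) (i : G) : 0 ≤ x i := by
  have key : ∀ n : ℕ, x (n • i) ≤ n * x i := by
    intro n
    induction n with
    | zero => simp [hx.1]
    | succ n ih =>
      have := groupCone_add_le hx (n • i) i
      rw [succ_nsmul]
      push_cast
      linarith
  have h := key (addOrderOf i)
  rw [addOrderOf_nsmul_eq_zero, hx.1] at h
  have hpos : (0 : ℝ) < addOrderOf i := by exact_mod_cast addOrderOf_pos i
  exact nonneg_of_mul_nonneg_right h hpos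

theorem groupCone_neg_eq_zero {G : Type*} [AddCommGroup G] [Finite G] {x : G → ℝ}
    (hx : x ∈ groupCone G) {h : G} (hh : x h = 0) : x (-h) = 0 := by
  have key : ∀ n : ℕ, x (n • h) = 0 := by
    intro n
    induction n with
    | zero => simp [hx.1]
    | succ n ih =>
      have := groupCone_add_le hx (n • h) h
      have h2 := groupCone_nonneg hx (n • h + h)
      rw [succ_nsmul]
      linarith
  have e : (addOrderOf h - 1) • h = -h := by
    have := addOrderOf_pos h
    rw [eq_neg_iff_add_eq_zero, ← succ_nsmul, Nat.sub_add_cancel this, addOrderOf_nsmul_eq_zero]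
  rw [← e]
  exact key _

theorem IsFace.subset {G : Type*} [AddCommGroup G] {F : Set (G → ℝ)}
    (hF : IsFace F) : F ⊆ groupCone G := by
  obtain ⟨T, -, rfl⟩ := hF
  exact fun x hx => hx.1

theorem groupCone_add_right {G : Type*} [AddCommGroup G] [Finite G] {x : G → ℝ}
    (hx : x ∈ groupCone G) {h : G} (hh : x h = 0) (a : G) : x (a + h) = x a := by
  have h1 := groupCone_add_le hx a h
  have h2 := groupCone_add_le hx (a + h) (-h)
  rw [add_neg_cancel_right, groupCone_neg_eq_zero hx hh] at h2
  linarith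

/-- A poset whose ground set is the quotient of `G` by a subgroup. -/
structure QuotientPoset (G : Type*) [AddCommGroup G] where
  /-- The subgroup by which the quotient is taken. -/
  subgroup : AddSubgroup G
  /-- The partial order on the quotient. -/
  order : PartialOrder (G ⧸ subgroup)

instance {G : Type*} [AddCommGroup G] (P : QuotientPoset G) : PartialOrder (G ⧸ P.subgroup) :=
  P.order

theorem QuotientPoset.ext_of {G : Type*} [AddCommGroup G] {P Q : QuotientPoset G}
    (h : P.subgroup = Q.subgroup)
    (hle : ∀ a b : G, (a : G ⧸ P.subgroup) ≤ (b : G ⧸ P.subgroup) ↔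
      (a : G ⧸ Q.subgroup) ≤ (b : G ⧸ Q.subgroup)) : P = Q := by
  obtain ⟨K, oP⟩ := P
  obtain ⟨K', oQ⟩ := Q
  obtain rfl : K = K' := h
  congr 1
  apply PartialOrder.ext
  intro a b
  induction a using QuotientAddGroup.induction_on
  induction b using QuotientAddGroup.induction_on
  exact hle _ _

/-- The Kunz subgroup `{h : x h = 0 for all x ∈ F}` of a face `F`. -/
def kunzSubgroup {G : Type*} [AddCommGroup G] [Finite G] {F : Set (G → ℝ)} (hF : IsFace F) :
    AddSubgroup G where
  carrier := {h | ∀ x ∈ F, x h = 0}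
  zero_mem' := fun x hx => (hF.subset hx).1
  add_mem' := fun {a b} ha hb x hx => by
    rw [groupCone_add_right (hF.subset hx) (hb x hx), ha x hx]
  neg_mem' := fun {a} ha x hx => groupCone_neg_eq_zero (hF.subset hx) (ha x hx)

theorem face_apply_eq {G : Type*} [AddCommGroup G] [Finite G] {F : Set (G → ℝ)}
    (hF : IsFace F) {a b : G} (hab : -a + b ∈ kunzSubgroup hF) {x : G → ℝ} (hx : x ∈ F) :
    x a = x b := by
  have := groupCone_add_right (hF.subset hx) (hab x hx) a
  rw [add_neg_cancel_left] at this
  exact this.symm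

/-- The Kunz poset of a face `F`: its ground set is the quotient of `G` by the Kunz subgroup, and
the class of `a` is below the class of `b` exactly if `x a + x (b - a) = x b` for all `x ∈ F`. -/
def kunzPoset {G : Type*} [AddCommGroup G] [Finite G] {F : Set (G → ℝ)} (hF : IsFace F) :
    QuotientPoset G where
  subgroup := kunzSubgroup hF
  order :=
    { le := fun p q => Quotient.liftOn₂' p q (fun a b => ∀ x ∈ F, x a + x (b - a) = x b) (by
        intro a b a' b' ha hb
        rw [QuotientAddGroup.leftRel_apply] at ha hb
        apply propext
        refine forall₂_congr fun x hx => ?_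
        have hd : -(b - a) + (b' - a') ∈ kunzSubgroup hF := by
          have : -(b - a) + (b' - a') = (-b + b') - (-a + a') := by abel
          rw [this]
          exact sub_mem hb ha
        rw [face_apply_eq hF ha hx, face_apply_eq hF hb hx, face_apply_eq hF hd hx])
      le_refl := by
        intro p
        induction p using QuotientAddGroup.induction_on with | H a => ?_
        intro x hx
        simp [(hF.subset hx).1]
      le_trans := by
        intro p q r
        induction p using QuotientAddGroup.induction_on with | H a => ?_
        induction q using QuotientAddGroup.induction_on with | H b => ?_
        induction r using QuotientAddGroup.induction_on with | H c => ?_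
        intro hab hbc x hx
        have h1 := hab x hx
        have h2 := hbc x hx
        have h3 := groupCone_add_le (hF.subset hx) (b - a) (c - b)
        have h4 := groupCone_add_le (hF.subset hx) a (c - a)
        rw [show b - a + (c - b) = c - a by abel] at h3
        rw [show a + (c - a) = c by abel] at h4
        linarith
      le_antisymm := by
        intro p q
        induction p using QuotientAddGroup.induction_on with | H a => ?_
        induction q using QuotientAddGroup.induction_on with | H b => ?_
        intro hab hba
        rw [QuotientAddGroup.eq]
        intro x hx
        have h1 := hab x hx
        have h2 := hba x hx
        have h3 := groupCone_nonneg (hF.subset hx) (b - a)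
        have h4 := groupCone_nonneg (hF.subset hx) (a - b)
        rw [show -a + b = b - a by abel]
        linarith }

theorem kunzPoset_le_iff {G : Type*} [AddCommGroup G] [Finite G] {F : Set (G → ℝ)}
    (hF : IsFace F) (a b : G) :
    (a : G ⧸ (kunzPoset hF).subgroup) ≤ (b : G ⧸ (kunzPoset hF).subgroup) ↔
      ∀ x ∈ F, x a + x (b - a) = x b :=
  Iff.rfl

/-! ### Monoscopic embeddings, beta rays and monoscopic extensions

Here `H` is a subgroup of `G`, and the image of `ρ` generates `G ⧸ H`. -/

/-- The image of `ρ` in `G ⧸ H` is a generator (so that `G ⧸ H` is cyclic). -/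
def GeneratesQuotient {G : Type*} [AddCommGroup G] (H : AddSubgroup G) (ρ : G) : Prop :=
  AddSubgroup.zmultiples (ρ : G ⧸ H) = ⊤

theorem addOrderOf_eq_index {G : Type*} [AddCommGroup G] {H : AddSubgroup G} {ρ : G}
    (hρ : GeneratesQuotient H ρ) : addOrderOf (ρ : G ⧸ H) = H.index := by
  rw [← Nat.card_zmultiples, hρ, AddSubgroup.card_top]
  rfl

theorem decomposition_bijective {G : Type*} [AddCommGroup G] [Finite G] {H : AddSubgroup G}
    {ρ : G} (hρ : GeneratesQuotient H ρ) :
    Function.Bijective fun p : H × Fin H.index => (p.1 : G) + (p.2 : ℕ) • ρ := by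
  classical
  have hord := addOrderOf_eq_index hρ
  constructor
  · rintro ⟨a, b⟩ ⟨a', b'⟩ h
    simp only at h
    have hq : (b : ℕ) • (ρ : G ⧸ H) = (b' : ℕ) • (ρ : G ⧸ H) := by
      have := congrArg (fun g : G => (g : G ⧸ H)) h
      simpa [(QuotientAddGroup.eq_zero_iff _).mpr a.2, (QuotientAddGroup.eq_zero_iff _).mpr a'.2]
        using this
    have hb : (b : ℕ) = b' :=
      nsmul_injOn_Iio_addOrderOf (by rw [hord]; exact b.2) (by rw [hord]; exact b'.2) hq
    rw [hb] at h
    have ha : (a : G) = a' := add_right_cancel h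
    exact Prod.ext (Subtype.ext ha) (Fin.ext hb)
  · intro g
    have hg : (g : G ⧸ H) ∈ AddSubgroup.zmultiples (ρ : G ⧸ H) := by
      rw [hρ]; exact AddSubgroup.mem_top _
    rw [mem_zmultiples_iff_mem_range_addOrderOf] at hg
    obtain ⟨b, hb, hbg⟩ := Finset.mem_image.mp hg
    rw [Finset.mem_range, hord] at hb
    have hm : g - b • ρ ∈ H := by
      rw [← QuotientAddGroup.eq_zero_iff]
      simp [← hbg]
    exact ⟨(⟨g - b • ρ, hm⟩, ⟨b, hb⟩), by simp⟩

/-- Every element of `G` is uniquely `a + b ρ` with `a ∈ H` and `0 ≤ b < β`, for `β = |G / H|`. -/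
noncomputable def decomposition {G : Type*} [AddCommGroup G] [Finite G] {H : AddSubgroup G}
    {ρ : G} (hρ : GeneratesQuotient H ρ) : H × Fin H.index ≃ G :=
  Equiv.ofBijective (fun p : H × Fin H.index => (p.1 : G) + (p.2 : ℕ) • ρ)
    (decomposition_bijective hρ)

/-- The element `β ρ` of `H`, where `β = |G / H|`. -/
noncomputable def betaRho {G : Type*} [AddCommGroup G] (H : AddSubgroup G) (ρ : G) : H :=
  ⟨H.index • ρ, AddSubgroup.nsmul_index_mem H ρ⟩

/-- The monoscopic embedding `Φ_ρ`: it sends `w` to `x` with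
`x (a + b ρ) = β * w a + b * w (β ρ)` for `a ∈ H` and `0 ≤ b < β`. -/
noncomputable def monoscopicEmbedding {G : Type*} [AddCommGroup G] [Finite G] {H : AddSubgroup G}
    {ρ : G} (hρ : GeneratesQuotient H ρ) (w : H → ℝ) : G → ℝ := fun g =>
  (H.index : ℝ) * w ((decomposition hρ).symm g).1 +
    (((decomposition hρ).symm g).2 : ℕ) * w (betaRho H ρ)

/-- The beta ray `s`: `s (a + b ρ) = b` for `a ∈ H` and `0 ≤ b < β`. -/
noncomputable def betaRay {G : Type*} [AddCommGroup G] [Finite G] {H : AddSubgroup G}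
    {ρ : G} (hρ : GeneratesQuotient H ρ) : G → ℝ := fun g =>
  (((decomposition hρ).symm g).2 : ℕ)

theorem quotient_decomposition {G : Type*} [AddCommGroup G] [Finite G] {H : AddSubgroup G}
    {ρ : G} (hρ : GeneratesQuotient H ρ) (K : AddSubgroup H) {a a' : H} {b b' : Fin H.index}
    (h : (((a : G) + (b : ℕ) • ρ : G) : G ⧸ K.map H.subtype) =
      (((a' : G) + (b' : ℕ) • ρ : G) : G ⧸ K.map H.subtype)) :
    (a : H ⧸ K) = (a' : H ⧸ K) ∧ b = b' := by
  rw [QuotientAddGroup.eq] at h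
  obtain ⟨k, hk, hkeq⟩ := h
  have e : (((a + k : H), b) : H × Fin H.index) = (a', b') := by
    apply (decomposition_bijective hρ).1
    have hk' : (k : G) = -((a : G) + (b : ℕ) • ρ) + ((a' : G) + (b' : ℕ) • ρ) := hkeq
    simp only [AddSubgroup.coe_add]
    rw [hk']
    abel
  obtain ⟨h1, h2⟩ := Prod.mk.inj e
  refine ⟨?_, h2⟩
  rw [QuotientAddGroup.eq, ← h1, neg_add_cancel_left]
  exact hk

/-- The monoscopic extension along `ρ` of a poset on `H / H'`: the poset on `G / H'` with
`a + b ρ ≤ a' + b' ρ` exactly if `a ≤ a'` and `b ≤ b'`, for `a, a'` in `H / H'` and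
`0 ≤ b, b' < β`. -/
def monoscopicExtension {G : Type*} [AddCommGroup G] [Finite G] {H : AddSubgroup G}
    {ρ : G} (hρ : GeneratesQuotient H ρ) (P : QuotientPoset H) : QuotientPoset G where
  subgroup := P.subgroup.map H.subtype
  order :=
    { le := fun q q' => ∃ (a a' : H) (b b' : Fin H.index),
        q = (((a : G) + (b : ℕ) • ρ : G) : G ⧸ P.subgroup.map H.subtype) ∧
        q' = (((a' : G) + (b' : ℕ) • ρ : G) : G ⧸ P.subgroup.map H.subtype) ∧
        (a : H ⧸ P.subgroup) ≤ (a' : H ⧸ P.subgroup) ∧ b ≤ b'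
      le_refl := by
        intro q
        induction q using QuotientAddGroup.induction_on with | H g => ?_
        obtain ⟨⟨a, b⟩, rfl⟩ := (decomposition_bijective hρ).2 g
        exact ⟨a, a, b, b, rfl, rfl, le_rfl, le_rfl⟩
      le_trans := by
        rintro q q' q'' ⟨a, a', b, b', h1, h2, h3, h4⟩ ⟨c, c', d, d', k1, k2, k3, k4⟩
        obtain ⟨e1, e2⟩ := quotient_decomposition hρ P.subgroup (h2.symm.trans k1)
        exact ⟨a, c', b, d', h1, k2, (h3.trans e1.le).trans k3, (h4.trans e2.le).trans k4⟩
      le_antisymm := by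
        rintro q q' ⟨a, a', b, b', h1, h2, h3, h4⟩ ⟨c, c', d, d', k1, k2, k3, k4⟩
        obtain ⟨e1, e2⟩ := quotient_decomposition hρ P.subgroup (h2.symm.trans k1)
        obtain ⟨f1, f2⟩ := quotient_decomposition hρ P.subgroup (h1.symm.trans k2)
        have ha : (a : H ⧸ P.subgroup) = (a' : H ⧸ P.subgroup) :=
          le_antisymm h3 ((e1.le.trans k3).trans f1.symm.le)
        have hb : b = b' := le_antisymm h4 ((e2.le.trans k4).trans f2.symm.le)
        rw [h1, h2, QuotientAddGroup.eq, hb]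
        rw [QuotientAddGroup.eq] at ha
        refine ⟨-a + a', ha, ?_⟩
        simp only [AddSubgroup.subtype_apply, AddSubgroup.coe_add, NegMemClass.coe_neg]
        abel }

/-! Write S for the set `ℝ≥0 s + Φ_ρ(F)` and β for the index of H. At a + bρ a point of S takes the
value β w_a + b (c + w_{βρ}), which is additive in (a, b) apart from the carry when b + b' ≥ β. So
without a carry an equality for (a, a') valid on F lifts to one for (a + bρ, a' + b'ρ) valid on S.
Conversely, let x in C(G) satisfy every equality valid on S. The lifted ones give x_{a+bρ} = x_a + b
x_ρ, so x is determined by its restriction to H and by x_ρ. Then w = x|_H / β lies in F, and c = x_ρ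
- x_{βρ} / β is nonnegative by subadditivity, so x lies in S; hence S is a face
(`isFace_monoscopicCone`). The Kunz subgroup and poset are read off by evaluating on S: the ray s
detects b, and `Φ_ρ(F)` detects a. -/

/-! ### Faces described by all their valid equalities -/

/-- A subset of the group cone is a face as soon as it contains every point of the cone that
satisfies all the additive equalities valid on it, for arbitrary pairs of indices. -/
theorem isFace_of_forall_eq {G : Type*} [AddCommGroup G] [Finite G] {S : Set (G → ℝ)}
    (hS : S ⊆ groupCone G)
    (h : ∀ x ∈ groupCone G,
      (∀ i j : G, (∀ y ∈ S, y i + y j = y (i + j)) → x i + x j = x (i + j)) → x ∈ S) :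
    IsFace S := by
  refine ⟨{p | IsFacetIndex p.1 p.2 ∧ ∀ y ∈ S, y p.1 + y p.2 = y (p.1 + p.2)},
    fun p hp => hp.1, ?_⟩
  apply Set.Subset.antisymm
  · exact fun x hx => ⟨hS hx, fun p hp => hp.2 x hx⟩
  · rintro x ⟨hx, hT⟩
    have key : ∀ i j : G, IsFacetIndex i j → (∀ y ∈ S, y i + y j = y (i + j)) →
        x i + x j = x (i + j) := fun i j hij hy => hT (i, j) ⟨hij, hy⟩
    refine h x hx fun i j hy => ?_
    by_cases hi : i = 0
    · simp [hi, hx.1]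
    by_cases hj : j = 0
    · simp [hj, hx.1]
    by_cases hij : i + j = 0
    · by_cases hc : Nat.card G = 2
      · exact key i j ⟨hi, hj, Or.inr hc⟩ hy
      · have hk : ∃ k : G, k ≠ 0 ∧ k ≠ j := by
          by_contra! hk
          apply hc
          rw [Nat.card_eq_two_iff]
          refine ⟨0, j, fun h => hj h.symm, ?_⟩
          ext k
          by_cases h : k = 0
          · simp [h]
          · simp [hk k h]
        obtain ⟨k, hk0, hkj⟩ := hk
        have hji : j = -i := eq_neg_of_add_eq_zero_right hij
        have hik : i + k ≠ 0 := by
          intro h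
          exact hkj (by rw [hji, eq_neg_of_add_eq_zero_right h])
        have e : j + (i + k) = k := by rw [hji]; abel
        -- The pair (i, -i) need not index a facet. Its equality forces y_i = y_{-i} = 0 on S, so
        -- the facet equalities for (i, k) and (-i, i + k) also hold on S; for x these two add up to
        -- x_i + x_{-i} = 0.
        have hzero : ∀ y ∈ S, y i = 0 ∧ y j = 0 := by
          intro y hyS
          have h1 := hy y hyS
          rw [hij, (hS hyS).1] at h1
          have h2 := groupCone_nonneg (hS hyS) i
          have h3 := groupCone_nonneg (hS hyS) j
          constructor <;> linarith
        have h1 := key i k ⟨hi, hk0, Or.inl hik⟩ fun y hyS => by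
          rw [(hzero y hyS).1, add_comm i k, groupCone_add_right (hS hyS) (hzero y hyS).1, zero_add]
        have h2 := key j (i + k) ⟨hj, hik, Or.inl (by rw [e]; exact hk0)⟩ fun y hyS => by
          rw [(hzero y hyS).2, add_comm j, groupCone_add_right (hS hyS) (hzero y hyS).2, zero_add]
        rw [e] at h2
        rw [hij, hx.1]
        linarith
    · exact key i j ⟨hi, hj, Or.inl hij⟩ hy

theorem IsFace.mem_of_forall_eq {G : Type*} [AddCommGroup G] {F : Set (G → ℝ)} (hF : IsFace F)
    {x : G → ℝ} (hx : x ∈ groupCone G)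
    (h : ∀ i j : G, (∀ y ∈ F, y i + y j = y (i + j)) → x i + x j = x (i + j)) : x ∈ F := by
  obtain ⟨T, -, rfl⟩ := hF
  exact ⟨hx, fun p hp => h p.1 p.2 fun y hy => hy.2 p hp⟩

/-- Taking w = 0 puts the ray s itself into the cone over F. -/
theorem IsFace.zero_mem {G : Type*} [AddCommGroup G] {F : Set (G → ℝ)} (hF : IsFace F) :
    (0 : G → ℝ) ∈ F :=
  hF.mem_of_forall_eq ⟨rfl, fun _ _ _ => by simp⟩ fun _ _ _ => by simp

/-! ### Arithmetic of a + bρ, with and without carry -/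

theorem coe_add_nsmul_add_of_le {G : Type*} [AddCommGroup G] {H : AddSubgroup G} {ρ : G}
    (a a' : H) {b b' : ℕ} (h : H.index ≤ b + b') :
    (a : G) + b • ρ + ((a' : G) + b' • ρ) =
      ((a + a' + betaRho H ρ : H) : G) + (b + b' - H.index) • ρ := by
  have e : b • ρ + b' • ρ = H.index • ρ + (b + b' - H.index) • ρ := by
    rw [← add_nsmul, ← add_nsmul, Nat.add_sub_cancel' h]
  have e' : ((a + a' + betaRho H ρ : H) : G) = (a : G) + a' + H.index • ρ := rfl
  rw [e', add_assoc _ (H.index • ρ), ← e]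
  abel

theorem coe_add_nsmul_add {G : Type*} [AddCommGroup G] {H : AddSubgroup G} {ρ : G}
    (a a' : H) (b b' : ℕ) :
    (a : G) + b • ρ + ((a' : G) + b' • ρ) = ((a + a' : H) : G) + (b + b') • ρ := by
  rw [add_nsmul, AddSubgroup.coe_add]
  abel

theorem coe_add_nsmul_sub {G : Type*} [AddCommGroup G] {H : AddSubgroup G} {ρ : G}
    (a a' : H) {b b' : ℕ} (h : b ≤ b') :
    (a' : G) + b' • ρ - ((a : G) + b • ρ) = ((a' - a : H) : G) + (b' - b) • ρ := by
  obtain ⟨k, rfl⟩ := Nat.exists_eq_add_of_le h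
  rw [Nat.add_sub_cancel_left, add_nsmul, AddSubgroup.coe_sub]
  abel

section Monoscopic

variable {G : Type*} [AddCommGroup G] [Finite G] {H : AddSubgroup G} {ρ : G}

theorem decomposition_symm_apply (hρ : GeneratesQuotient H ρ) (a : H) {b : ℕ} (hb : b < H.index) :
    (decomposition hρ).symm ((a : G) + b • ρ) = (a, ⟨b, hb⟩) :=
  (decomposition hρ).symm_apply_apply (a, ⟨b, hb⟩)

theorem exists_eq_add_nsmul (hρ : GeneratesQuotient H ρ) (g : G) :
    ∃ (a : H) (b : ℕ), b < H.index ∧ g = (a : G) + b • ρ := by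
  obtain ⟨⟨a, b⟩, rfl⟩ := (decomposition_bijective hρ).2 g
  exact ⟨a, b, b.2, rfl⟩

/-! ### The cone over F lies in the group cone -/

theorem smul_betaRay_add_monoscopicEmbedding_apply (hρ : GeneratesQuotient H ρ) (c : ℝ)
    (w : H → ℝ) (a : H) {b : ℕ} (hb : b < H.index) :
    (c • betaRay hρ + monoscopicEmbedding hρ w) ((a : G) + b • ρ) =
      H.index * w a + b * (c + w (betaRho H ρ)) := by
  simp only [Pi.add_apply, Pi.smul_apply, smul_eq_mul, betaRay, monoscopicEmbedding,
    decomposition_symm_apply hρ a hb]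
  ring

theorem smul_betaRay_add_monoscopicEmbedding_mem_groupCone (hρ : GeneratesQuotient H ρ) {c : ℝ}
    (hc : 0 ≤ c) {w : H → ℝ} (hw : w ∈ groupCone H) :
    c • betaRay hρ + monoscopicEmbedding hρ w ∈ groupCone G := by
  have hβ : 0 < H.index := Nat.pos_of_ne_zero AddSubgroup.FiniteIndex.index_ne_zero
  have happ := smul_betaRay_add_monoscopicEmbedding_apply hρ c w
  constructor
  · simpa [hw.1] using happ 0 hβ
  · rintro i j -
    obtain ⟨a, b, hb, rfl⟩ := exists_eq_add_nsmul hρ i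
    obtain ⟨a', b', hb', rfl⟩ := exists_eq_add_nsmul hρ j
    have h1 := groupCone_add_le hw a a'
    -- Without a carry the slack is β (w_a + w_{a'} - w_{a+a'}). With a carry, βρ moves into the
    -- H-part and the slack is β (c + w_a + w_{a'} + w_{βρ} - w_{a+a'+βρ}), where c ≥ 0 is used.
    rcases lt_or_ge (b + b') H.index with h | h
    · rw [coe_add_nsmul_add, happ _ h, happ _ hb, happ _ hb']
      push_cast
      nlinarith [Nat.cast_nonneg (α := ℝ) H.index]
    · rw [coe_add_nsmul_add_of_le _ _ h, happ _ (by omega : b + b' - H.index < H.index), happ _ hb,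
        happ _ hb', Nat.cast_sub h]
      push_cast
      have h2 := groupCone_add_le hw (a + a') (betaRho H ρ)
      have h3 : (0 : ℝ) ≤ H.index * (c + (w a + w a' + w (betaRho H ρ) -
          w (a + a' + betaRho H ρ))) :=
        mul_nonneg (Nat.cast_nonneg _) (by linarith)
      linarith

/-- The cone `ℝ≥0 s + Φ_ρ(F)`. -/
def monoscopicCone (hρ : GeneratesQuotient H ρ) (F : Set (H → ℝ)) : Set (G → ℝ) :=
  {x : G → ℝ | ∃ c : ℝ, 0 ≤ c ∧ ∃ w ∈ F, x = c • betaRay hρ + monoscopicEmbedding hρ w}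

theorem monoscopicCone_subset (hρ : GeneratesQuotient H ρ) {F : Set (H → ℝ)} (hF : IsFace F) :
    monoscopicCone hρ F ⊆ groupCone G := by
  rintro _ ⟨c, hc, w, hw, rfl⟩
  exact smul_betaRay_add_monoscopicEmbedding_mem_groupCone hρ hc (hF.subset hw)

theorem nsmul_apply_le {x : G → ℝ} (hx : x ∈ groupCone G) (g : G) (n : ℕ) :
    x (n • g) ≤ n * x g := by
  induction n with
  | zero => simp [hx.1]
  | succ n ih =>
    have := groupCone_add_le hx (n • g) g
    rw [succ_nsmul]
    push_cast
    linarith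

/-! ### The cone over F is a face -/

theorem isFace_monoscopicCone (hρ : GeneratesQuotient H ρ) {F : Set (H → ℝ)} (hF : IsFace F) :
    IsFace (monoscopicCone hρ F) := by
  have hβ : 0 < H.index := Nat.pos_of_ne_zero AddSubgroup.FiniteIndex.index_ne_zero
  have hβ' : (0 : ℝ) < H.index := by exact_mod_cast hβ
  refine isFace_of_forall_eq (monoscopicCone_subset hρ hF) fun x hx heq => ?_
  have key : ∀ (a a' : H) (b b' : ℕ), b + b' < H.index →
      (∀ w ∈ F, w a + w a' = w (a + a')) →
      x ((a : G) + b • ρ) + x ((a' : G) + b' • ρ) = x (((a + a' : H) : G) + (b + b') • ρ) := by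
    intro a a' b b' hb hw
    rw [← coe_add_nsmul_add]
    apply heq
    rintro _ ⟨c, -, w, hwF, rfl⟩
    rw [coe_add_nsmul_add, smul_betaRay_add_monoscopicEmbedding_apply hρ c w _ hb,
      smul_betaRay_add_monoscopicEmbedding_apply hρ c w a (by omega),
      smul_betaRay_add_monoscopicEmbedding_apply hρ c w a' (by omega), ← hw w hwF]
    push_cast
    ring
  have hmul : ∀ b : ℕ, b < H.index → x (b • ρ) = b * x ρ := by
    intro b
    induction b with
    | zero => simp [hx.1]
    | succ b ih =>
      intro hb
      have h := key 0 0 b 1 hb fun w hw => by simp [(hF.subset hw).1]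
      simp only [add_zero, AddSubgroup.coe_zero, zero_add, one_nsmul] at h
      rw [← h, ih (by omega)]
      push_cast
      ring
  have hx' : ∀ (a : H) (b : ℕ), b < H.index → x ((a : G) + b • ρ) = x a + b * x ρ := by
    intro a b hb
    have h := key a 0 0 b (by omega) fun w hw => by simp [(hF.subset hw).1]
    simp only [add_zero, AddSubgroup.coe_zero, zero_add, zero_nsmul] at h
    rw [← h, hmul b hb]
  have hbeta : x (betaRho H ρ : H) ≤ H.index * x ρ := nsmul_apply_le hx ρ H.index
  -- Comparing β w_a + b (c + w_{βρ}) with x_a + b x_ρ forces w = x|_H / β and c = x_ρ - w_{βρ}. For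
  -- β = 1 this gives c = 0, so the value x_ρ causes no trouble.
  refine ⟨x ρ - x (betaRho H ρ : H) / H.index, ?_, fun a => x a / H.index, ?_, ?_⟩
  · rw [sub_nonneg, div_le_iff₀ hβ']
    linarith
  · refine hF.mem_of_forall_eq ⟨by simp [hx.1], fun i j _ => ?_⟩ fun i j hij => ?_
    · rw [← add_div]
      exact div_le_div_of_nonneg_right (groupCone_add_le hx i j) hβ'.le
    · have h := key i j 0 0 (by omega) hij
      simp only [add_zero, zero_nsmul] at h
      rw [← add_div, h]
  · ext g
    obtain ⟨a, b, hb, rfl⟩ := exists_eq_add_nsmul hρ g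
    rw [smul_betaRay_add_monoscopicEmbedding_apply hρ _ _ a hb, hx' a b hb]
    field_simp
    ring

/-! ### Kunz subgroup and Kunz poset of the cone -/

theorem forall_mem_monoscopicCone_apply_eq_zero_iff (hρ : GeneratesQuotient H ρ)
    {F : Set (H → ℝ)} (hF : IsFace F) (a : H) {b : ℕ} (hb : b < H.index) :
    (∀ x ∈ monoscopicCone hρ F, x ((a : G) + b • ρ) = 0) ↔ b = 0 ∧ ∀ w ∈ F, w a = 0 := by
  have hβ : (H.index : ℝ) ≠ 0 := by exact_mod_cast AddSubgroup.FiniteIndex.index_ne_zero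
  constructor
  · intro h
    have hb0 : b = 0 := by
      have := h _ ⟨1, zero_le_one, 0, hF.zero_mem, rfl⟩
      rw [smul_betaRay_add_monoscopicEmbedding_apply hρ _ _ a hb] at this
      simpa using this
    refine ⟨hb0, fun w hw => ?_⟩
    have := h _ ⟨0, le_rfl, w, hw, rfl⟩
    rw [smul_betaRay_add_monoscopicEmbedding_apply hρ _ _ a hb] at this
    simpa [hb0, hβ] using this
  · rintro ⟨rfl, h⟩ _ ⟨c, -, w, hw, rfl⟩
    rw [smul_betaRay_add_monoscopicEmbedding_apply hρ _ _ a hb]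
    simp [h w hw]

theorem forall_mem_monoscopicCone_apply_add_eq_iff (hρ : GeneratesQuotient H ρ)
    {F : Set (H → ℝ)} (hF : IsFace F) (a a' : H) {b b' : ℕ} (hb : b < H.index)
    (hb' : b' < H.index) :
    (∀ x ∈ monoscopicCone hρ F,
      x ((a : G) + b • ρ) + x ((a' : G) + b' • ρ - ((a : G) + b • ρ)) = x ((a' : G) + b' • ρ)) ↔
      (∀ w ∈ F, w a + w (a' - a) = w a') ∧ b ≤ b' := by
  have hβ : (H.index : ℝ) ≠ 0 := by exact_mod_cast AddSubgroup.FiniteIndex.index_ne_zero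
  have happ := smul_betaRay_add_monoscopicEmbedding_apply hρ
  constructor
  · intro h
    -- On s the equality reads b + s(difference) = b'. Nonnegativity of s suffices, so the carry
    -- that occurs in the difference when b > b' need not be computed.
    have hle : b ≤ b' := by
      have hmem : (1 : ℝ) • betaRay hρ + monoscopicEmbedding hρ 0 ∈ monoscopicCone hρ F :=
        ⟨1, zero_le_one, 0, hF.zero_mem, rfl⟩
      have h1 := h _ hmem
      have h2 := groupCone_nonneg (monoscopicCone_subset hρ hF hmem)
        ((a' : G) + b' • ρ - ((a : G) + b • ρ))
      rw [happ _ _ _ hb, happ _ _ _ hb'] at h1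
      simp only [Pi.zero_apply, mul_zero, add_zero, mul_one, zero_add] at h1
      have h3 : (b : ℝ) ≤ b' := by linarith
      exact_mod_cast h3
    refine ⟨fun w hw => ?_, hle⟩
    have h1 := h _ ⟨0, le_rfl, w, hw, rfl⟩
    rw [coe_add_nsmul_sub a a' hle, happ _ _ _ hb, happ _ _ _ hb',
      happ _ _ _ (by omega : b' - b < H.index), Nat.cast_sub hle] at h1
    apply mul_left_cancel₀ hβ
    linarith
  · rintro ⟨h, hle⟩ _ ⟨c, -, w, hw, rfl⟩
    rw [coe_add_nsmul_sub a a' hle, happ _ _ _ hb, happ _ _ _ hb',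
      happ _ _ _ (by omega : b' - b < H.index), Nat.cast_sub hle, ← h w hw]
    ring

theorem monoscopicExtension_le_iff (hρ : GeneratesQuotient H ρ) (P : QuotientPoset H) (a a' : H)
    (b b' : Fin H.index) :
    (((a : G) + (b : ℕ) • ρ : G) : G ⧸ (monoscopicExtension hρ P).subgroup) ≤
      (((a' : G) + (b' : ℕ) • ρ : G) : G ⧸ (monoscopicExtension hρ P).subgroup) ↔
      (a : H ⧸ P.subgroup) ≤ (a' : H ⧸ P.subgroup) ∧ b ≤ b' := by
  constructor
  · rintro ⟨c, c', d, d', h1, h2, h3, h4⟩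
    obtain ⟨e1, e2⟩ := quotient_decomposition hρ P.subgroup h1
    obtain ⟨f1, f2⟩ := quotient_decomposition hρ P.subgroup h2
    exact ⟨(e1.le.trans h3).trans f1.symm.le, e2 ▸ f2 ▸ h4⟩
  · rintro ⟨h1, h2⟩
    exact ⟨a, a', b, b', rfl, rfl, h1, h2⟩

theorem kunzPoset_monoscopicCone (hρ : GeneratesQuotient H ρ) {F : Set (H → ℝ)} (hF : IsFace F)
    (hF' : IsFace (monoscopicCone hρ F)) :
    kunzPoset hF' = monoscopicExtension hρ (kunzPoset hF) := by
  refine QuotientPoset.ext_of ?_ fun g g' => ?_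
  · ext g
    obtain ⟨a, b, hb, rfl⟩ := exists_eq_add_nsmul hρ g
    refine (forall_mem_monoscopicCone_apply_eq_zero_iff hρ hF a hb).trans ⟨?_, ?_⟩
    · rintro ⟨rfl, h⟩
      exact ⟨a, h, by simp⟩
    · rintro ⟨k, hk, hka⟩
      -- An element of H has b = 0 by uniqueness of the decomposition.
      have e : ((k, ⟨0, by omega⟩) : H × Fin H.index) = (a, ⟨b, hb⟩) := by
        apply (decomposition_bijective hρ).1
        simpa using hka
      obtain ⟨rfl, h2⟩ := Prod.mk.inj e
      exact ⟨(Fin.mk.inj h2).symm, hk⟩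
  · obtain ⟨a, b, hb, rfl⟩ := exists_eq_add_nsmul hρ g
    obtain ⟨a', b', hb', rfl⟩ := exists_eq_add_nsmul hρ g'
    rw [kunzPoset_le_iff, forall_mem_monoscopicCone_apply_add_eq_iff hρ hF a a' hb hb']
    exact (monoscopicExtension_le_iff hρ (kunzPoset hF) a a' ⟨b, hb⟩ ⟨b', hb'⟩).symm

/-- A map that preserves and reflects the order is injective by antisymmetry, so only surjectivity
remains to be checked. -/
theorem exists_orderIso_monoscopicExtension (hρ : GeneratesQuotient H ρ) (P : QuotientPoset H) :
    ∃ e : (H ⧸ P.subgroup) × Fin H.index ≃o G ⧸ (monoscopicExtension hρ P).subgroup,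
      ∀ (a : H) (b : Fin H.index), e ((a : H ⧸ P.subgroup), b) =
        (((a : G) + (b : ℕ) • ρ : G) : G ⧸ (monoscopicExtension hρ P).subgroup) := by
  let f : (H ⧸ P.subgroup) × Fin H.index → G ⧸ (monoscopicExtension hρ P).subgroup := fun p =>
    QuotientAddGroup.map P.subgroup (P.subgroup.map H.subtype) H.subtype
      (AddSubgroup.le_comap_map _ _) p.1 + (((p.2 : ℕ) • ρ : G) : G ⧸ P.subgroup.map H.subtype)
  have hf : ∀ (a : H) (b : Fin H.index), f ((a : H ⧸ P.subgroup), b) =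
      (((a : G) + (b : ℕ) • ρ : G) : G ⧸ (monoscopicExtension hρ P).subgroup) := fun _ _ => rfl
  have hle : ∀ p q, f p ≤ f q ↔ p ≤ q := by
    rintro ⟨p, b⟩ ⟨q, b'⟩
    induction p using QuotientAddGroup.induction_on with | H a => ?_
    induction q using QuotientAddGroup.induction_on with | H a' => ?_
    rw [hf, hf, monoscopicExtension_le_iff, Prod.mk_le_mk]
  have hsurj : Function.Surjective f := by
    intro q
    induction q using QuotientAddGroup.induction_on with | H g => ?_
    obtain ⟨a, b, hb, rfl⟩ := exists_eq_add_nsmul hρ g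
    exact ⟨((a : H ⧸ P.subgroup), ⟨b, hb⟩), rfl⟩
  exact ⟨RelIso.ofSurjective (OrderEmbedding.ofMapLEIff f hle) hsurj, hf⟩

end Monoscopic

theorem theoremt {G : Type*} [AddCommGroup G] [Finite G] (H : AddSubgroup G) (ρ : G)
    (hρ : GeneratesQuotient H ρ) (F : Set (H → ℝ)) (hF : IsFace F) :
    ∃ hF' : IsFace {x : G → ℝ | ∃ c : ℝ, 0 ≤ c ∧ ∃ w ∈ F,
        x = c • betaRay hρ + monoscopicEmbedding hρ w},
      kunzPoset hF' = monoscopicExtension hρ (kunzPoset hF) ∧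
      ∃ e : (H ⧸ (kunzPoset hF).subgroup) × Fin H.index ≃o G ⧸ (kunzPoset hF').subgroup,
        ∀ (a : H) (b : Fin H.index),
          e ((a : H ⧸ (kunzPoset hF).subgroup), b) =
            (((a : G) + (b : ℕ) • ρ : G) : G ⧸ (kunzPoset hF').subgroup) := by
  have hF' : IsFace (monoscopicCone hρ F) := isFace_monoscopicCone hρ hF
  have heq := kunzPoset_monoscopicCone hρ hF hF'
  refine ⟨hF', heq, ?_⟩
  -- Refolds the set-builder form into `monoscopicCone`, so that `heq` can rewrite the dependent
  -- goal.
  change ∃ e : (H ⧸ (kunzPoset hF).subgroup) × Fin H.index ≃o G ⧸ (kunzPoset hF').subgroup,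
    ∀ (a : H) (b : Fin H.index), e ((a : H ⧸ (kunzPoset hF).subgroup), b) =
      (((a : G) + (b : ℕ) • ρ : G) : G ⧸ (kunzPoset hF').subgroup)
  rw [heq]
  exact exists_orderIso_monoscopicExtension hρ (kunzPoset hF)
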